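/- Consider the multi-armed bandit problem with $N$ actions. In each round $t = 1, 2, \ldots$ the player chooses a probability vector $p_t$ over $[N] = \{1, \ldots, N\}$; the environment, knowing the past and $p_t$, chooses a (possibly random) loss vector $\ell_t \in [0,1]^N$; then an action $i_t$ is drawn from $p_t$, independently of $\ell_t$ given the past and $p_t$, and the player observes $\ell_{t i_t}$ only. A (possibly randomized) algorithm chooses $p_t$ on the basis of $(p_s, i_s, \ell_{s i_s})_{s<t}$. For an algorithm, an environment, a horizon $T$ and an action $i^* \in [N]$, the pseudo-regret is $\bar R_{T i^*} = \mathbb{E}\big[\sum_{t=1}^T (\ell_t^\top p_t - \ell_{t i^*})\big]$. For $\Delta \in [0,1]$ and $C \ge 0$, an environment is in the adversarial regime with an $(i^*, \Delta, C, T)$ self-bounding constraint if $$\bar R_{T i^*} \;\ge\; \Delta \cdot \mathbb{E}\Big[\sum_{t=1}^T (1 - p_{t i^*})\Big] - C$$ holds for every algorithm. **Theorem.** There is an absolute constant $c > 0$ such that for all $\Delta \in (0, 1/4)$, all integers $N \ge 4$ and $T \ge 4 \log N$, all real $C \ge 0$, and every multi-armed bandit algorithm, there are an action $i^* \in [N]$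 and an environment in the adversarial regime with an $(i^*, \Delta, C, T)$ self-bounding constraint for which the pseudo-regret of the algorithm satisfies $$\bar R_{T i^*} \;\ge\; c \cdot \min\Big\{ \frac{N}{\Delta} + \sqrt{\frac{C N}{\Delta}},\; \sqrt{N T},\; T \Big\}.$$ In particular, for $T \ge N$ the lower bound is $c \cdot \min\big\{ N/\Delta + \sqrt{CN/\Delta},\, \sqrt{NT} \big\}$. -/

import Mathlib

open MeasureTheory ProbabilityTheory

noncomputable section

namespace Bandit

/-- Probability vectors over the `N` actions. -/
abbrev Simplex (N : ℕ) : Type := stdSimplex ℝ (Fin N)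

/-- Loss vectors in `[0, 1]^N`. -/
abbrev Loss (N : ℕ) : Type := Fin N → unitInterval

/-- What happens in one round: the player's probability vector `p`, the environment's loss
vector `ℓ`, and the action `i` drawn from `p`, arranged as `((p, ℓ), i)`. -/
abbrev Round (N : ℕ) : Type := (Simplex N × Loss N) × Fin N

/-- What the player of a bandit problem knows about one past round: `(p, i, ℓ i)`. -/
abbrev Feedback (N : ℕ) : Type := Simplex N × Fin N × unitInterval

/-- Sequences of length `n` of elements of `X`; the latest entry is the last component. -/
def Hist (X : Type) : ℕ → Type
  | 0 => Unit
  | n + 1 => Hist X n × X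

instance instMeasurableSpaceHist (X : Type) [MeasurableSpace X] :
    (n : ℕ) → MeasurableSpace (Hist X n)
  | 0 => inferInstanceAs (MeasurableSpace Unit)
  | n + 1 => @Prod.instMeasurableSpace (Hist X n) X (instMeasurableSpaceHist X n) _

/-- The part of a round that is revealed to the player. -/
def feedback {N : ℕ} (r : Round N) : Feedback N := (r.1.1, r.2, r.1.2 r.2)

/-- The part of a history that is revealed to the player. -/
def observe {N : ℕ} : (n : ℕ) → Hist (Round N) n → Hist (Feedback N) n
  | 0, _ => ()
  | n + 1, h => (observe n h.1, feedback h.2)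

theorem measurable_feedback {N : ℕ} : Measurable (feedback (N := N)) := by
  refine (measurable_fst.comp measurable_fst).prodMk (measurable_snd.prodMk ?_)
  exact measurable_from_prod_countable_left fun i => 
    (measurable_pi_apply i).comp measurable_snd

theorem measurable_observe {N : ℕ} : (n : ℕ) → Measurable (observe (N := N) n)
  | 0 => measurable_const
  | n + 1 => ((measurable_observe n).comp measurable_fst).prodMk
      (measurable_feedback.comp measurable_snd)

/-- A (possibly randomized) multi-armed bandit algorithm: after `n` rounds it chooses the next
probability vector, possibly at random, from the past probability vectors, the past actions and
the losses of those actions only. -/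
structure Algorithm (N : ℕ) where
  choose : (n : ℕ) → Kernel (Hist (Feedback N) n) (Simplex N)
  markov : ∀ n, IsMarkovKernel (choose n)

/-- A (possibly randomized and adaptive) environment: after `n` rounds it chooses the next loss
vector, possibly at random, from the whole past and the current probability vector of the player,
but without knowing the action that is about to be drawn. -/
structure Environment (N : ℕ) where
  choose : (n : ℕ) → Kernel (Hist (Round N) n × Simplex N) (Loss N)
  markov : ∀ n, IsMarkovKernel (choose n)

/-- Drawing an action from a probability vector. -/
def draw (N : ℕ) : Kernel (Simplex N) (Fin N) where
  toFun p := ∑ i, ENNReal.ofReal (p.1 i) • Measure.dirac i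
  measurable' := by
    refine Measure.measurable_of_measurable_coe _ fun s hs => ?_
    simp only [Measure.coe_finsetSum, Finset.sum_apply, Measure.smul_apply, smul_eq_mul]
    refine Finset.measurable_sum _ fun i _ => Measurable.mul_const ?_ _
    exact ((measurable_pi_apply i).comp measurable_subtype_coe).ennreal_ofReal

variable {N : ℕ}

/-- The conditional law of the next round `((p, ℓ), i)` given the first `n` rounds: `p` is chosen
by the algorithm, then `ℓ` by the environment, and `i` is drawn from `p`, independently of `ℓ`
given the past and `p`. -/
def nextRound (alg : Algorithm N) (env : Environment N) (n : ℕ) :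
    Kernel (Hist (Round N) n) (Round N) :=
  ((alg.choose n).comap (observe n) (measurable_observe n) ⊗ₖ env.choose n) ⊗ₖ
    (draw N).comap (fun x : Hist (Round N) n × (Simplex N × Loss N) => x.2.1)
      (measurable_fst.comp measurable_snd)

/-- The law of the first `n` rounds of the interaction of an algorithm with an environment. -/
def law (alg : Algorithm N) (env : Environment N) : (n : ℕ) → Measure (Hist (Round N) n)
  | 0 => (Measure.dirac () : Measure Unit)
  | n + 1 => law alg env n ⊗ₘ nextRound alg env n

/-- The sum of `f` over the entries of a sequence. -/
def total {X : Type} (f : X → ℝ) : (n : ℕ) → Hist X n → ℝ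
  | 0, _ => 0
  | n + 1, h => total f n h.1 + f h.2

/-- The pseudo-regret `E [∑ t ≤ T, (⟨ℓ t, p t⟩ - ℓ t i)]` with respect to the action `i`. -/
def pseudoRegret (alg : Algorithm N) (env : Environment N) (T : ℕ) (i : Fin N) : ℝ :=
  ∫ h, total (fun r : Round N => ∑ j, (r.1.2 j : ℝ) * r.1.1.1 j - (r.1.2 i : ℝ)) T h
    ∂(law alg env T)

/-- The environment is in the adversarial regime with an `(i, Δ, C, T)` self-bounding constraint:
for every algorithm, the pseudo-regret with respect to `i` is at least
`Δ * E [∑ t ≤ T, (1 - p t i)] - C`. -/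
def SelfBounding (env : Environment N) (i : Fin N) (Δ C : ℝ) (T : ℕ) : Prop :=
  ∀ alg : Algorithm N,
    Δ * (∫ h, total (fun r : Round N => 1 - r.1.1.1 i) T h ∂(law alg env T)) - C ≤
      pseudoRegret alg env T i

end Bandit

end

open MeasureTheory ProbabilityTheory

noncomputable section

namespace Bandit

variable {N : ℕ}

/-! The hard environments draw independent losses in which a hidden action `i` has advantage `e` for
`m` rounds and `1 / 2` afterwards, so that the regret is the sum of advantage times the probability
of missing `i`. The self-bounding constraint holds if `Δ ≤ e`, or if `m * Δ ≤ C`, when `C` pays for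
the first phase whatever the algorithm does (`selfBounding_gaps`).

With all advantages zero, every choice of `i` gives the same environment. Passing to advantage `e`
reweights the feedback by a likelihood ratio (`integral_observe_gapEnv`) whose divergence is of
order `e ^ 2` times the base number of plays of `i`. The base plays of all actions sum to `m`, so if
`m * e ^ 2 ≤ N / 16`, averaging over `i` gives an action that is missed in a third of the first `m`
rounds even when it has the advantage (`exists_integral_plays_le`). Hence the regret is at least `e
* m / 3`, and `exists_gap_and_duration` optimizes `e` and `m`. -/

/-- Bounded measurable real functions. -/
def BoundedMeasurable {α : Type*} [MeasurableSpace α] (f : α → ℝ) : Prop :=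
  Measurable f ∧ ∃ B : ℝ, ∀ x, |f x| ≤ B

/-! ### Closure properties of bounded measurable functions -/

namespace BoundedMeasurable

variable {α β : Type*} [MeasurableSpace α] [MeasurableSpace β] {f g : α → ℝ}

theorem integrable (hf : BoundedMeasurable f) (μ : Measure α) [IsFiniteMeasure μ] :
    Integrable f μ := by
  obtain ⟨hm, B, hB⟩ := hf
  exact Integrable.of_bound hm.aestronglyMeasurable B (Filter.Eventually.of_forall hB)

theorem const (c : ℝ) : BoundedMeasurable (fun _ : α => c) :=
  ⟨measurable_const, |c|, fun _ => le_rfl⟩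

theorem comp (hf : BoundedMeasurable f) {u : β → α} (hu : Measurable u) :
    BoundedMeasurable (fun x => f (u x)) :=
  ⟨hf.1.comp hu, hf.2.choose, fun x => hf.2.choose_spec (u x)⟩

theorem add (hf : BoundedMeasurable f) (hg : BoundedMeasurable g) :
    BoundedMeasurable (fun x => f x + g x) := by
  obtain ⟨hf, A, hA⟩ := hf
  obtain ⟨hg, B, hB⟩ := hg
  exact ⟨hf.add hg, A + B, fun x => (abs_add_le _ _).trans (add_le_add (hA x) (hB x))⟩

theorem mul (hf : BoundedMeasurable f) (hg : BoundedMeasurable g) :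
    BoundedMeasurable (fun x => f x * g x) := by
  obtain ⟨hf, A, hA⟩ := hf
  obtain ⟨hg, B, hB⟩ := hg
  refine ⟨hf.mul hg, A * B, fun x => ?_⟩
  rw [abs_mul]
  exact mul_le_mul (hA x) (hB x) (abs_nonneg _) ((abs_nonneg _).trans (hA x))

theorem sub (hf : BoundedMeasurable f) (hg : BoundedMeasurable g) :
    BoundedMeasurable (fun x => f x - g x) := by
  simpa [sub_eq_add_neg] using hf.add ((const (-1)).mul hg)

theorem sum {ι : Type*} (s : Finset ι) {f : ι → α → ℝ} (hf : ∀ i, BoundedMeasurable (f i)) :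
    BoundedMeasurable (fun x => ∑ i ∈ s, f i x) := by
  classical
  induction s using Finset.induction_on with
  | empty => simpa using const 0
  | insert a s ha ih =>
    simp only [Finset.sum_insert ha]
    exact (hf a).add ih

theorem exp (hf : BoundedMeasurable f) : BoundedMeasurable (fun x => Real.exp (f x)) := by
  obtain ⟨hf, A, hA⟩ := hf
  refine ⟨Real.measurable_exp.comp hf, Real.exp A, fun x => ?_⟩
  rw [Real.abs_exp]
  exact Real.exp_le_exp.2 ((le_abs_self _).trans (hA x))

theorem integral_kernel {f : α → β → ℝ} (hf : BoundedMeasurable (Function.uncurry f))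
    (κ : Kernel α β) [IsMarkovKernel κ] : BoundedMeasurable (fun x => ∫ y, f x y ∂κ x) := by
  obtain ⟨hf, B, hB⟩ := hf
  refine ⟨(hf.stronglyMeasurable.integral_kernel_prod_right).measurable, B, fun x => ?_⟩
  have := norm_integral_le_of_norm_le_const (μ := κ x) (f := f x)
    (Filter.Eventually.of_forall fun y => hB (x, y))
  simpa using this

end BoundedMeasurable

/-! ### Kernels and laws of the interaction -/

instance isMarkovKernel_draw (N : ℕ) : IsMarkovKernel (draw N) where
  isProbabilityMeasure p := by
    refine ⟨?_⟩
    have h : draw N p = ∑ i, ENNReal.ofReal (p.1 i) • Measure.dirac i := rfl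
    rw [h]
    simp only [Measure.coe_finsetSum, Finset.sum_apply, Measure.smul_apply, measure_univ,
      smul_eq_mul, mul_one]
    rw [← ENNReal.ofReal_sum_of_nonneg fun i _ => p.2.1 i, p.2.2, ENNReal.ofReal_one]

theorem integral_draw (p : Simplex N) (f : Fin N → ℝ) :
    ∫ j, f j ∂draw N p = ∑ j, p.1 j * f j := by
  have h : draw N p = ∑ i, ENNReal.ofReal (p.1 i) • Measure.dirac i := rfl
  rw [h, integral_finsetSum_measure]
  · refine Finset.sum_congr rfl fun j _ => ?_
    rw [integral_smul_measure, integral_dirac, ENNReal.toReal_ofReal (p.2.1 j), smul_eq_mul]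
  · intro j _
    exact (integrable_dirac (by simp)).smul_measure ENNReal.ofReal_ne_top

instance isMarkovKernel_algorithm (alg : Algorithm N) (n : ℕ) : IsMarkovKernel (alg.choose n) :=
  alg.markov n

instance isMarkovKernel_environment (env : Environment N) (n : ℕ) :
    IsMarkovKernel (env.choose n) :=
  env.markov n

instance isMarkovKernel_nextRound (alg : Algorithm N) (env : Environment N) (n : ℕ) :
    IsMarkovKernel (nextRound alg env n) := by
  unfold nextRound; infer_instance

instance isProbabilityMeasure_law (alg : Algorithm N) (env : Environment N) :
    (n : ℕ) → IsProbabilityMeasure (law alg env n)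
  | 0 => inferInstanceAs (IsProbabilityMeasure (Measure.dirac () : Measure Unit))
  | n + 1 => by
    have := isProbabilityMeasure_law alg env n
    exact inferInstanceAs (IsProbabilityMeasure (law alg env n ⊗ₘ nextRound alg env n))

theorem measurable_coord (j : Fin N) : Measurable (fun p : Simplex N => p.1 j) :=
  (measurable_pi_apply j).comp measurable_subtype_coe

theorem coord_le_one (p : Simplex N) (j : Fin N) : p.1 j ≤ 1 := by
  rw [← p.2.2]
  exact Finset.single_le_sum (f := p.1) (fun i _ => p.2.1 i) (Finset.mem_univ j)

theorem boundedMeasurable_coord (j : Fin N) :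
    BoundedMeasurable (fun p : Simplex N => p.1 j) :=
  ⟨measurable_coord j, 1, fun p => by
    rw [abs_of_nonneg (p.2.1 j)]; exact coord_le_one p j⟩

/-! ### Stochastic environments with one advantaged action -/

/-- The loss vector that is `0` at `i` and `1` elsewhere. -/
def spike (i : Fin N) : Loss N := fun j => if j = i then 0 else 1

/-- A distribution of losses under which all losses are fair coins, except that the loss of `i`
has mean `1 / 2 - g`. -/
def lossLaw (i : Fin N) (g : ℝ) : Measure (Loss N) :=
  ENNReal.ofReal (1 / 2 - g) • Measure.dirac 1 + ENNReal.ofReal g • Measure.dirac (spike i) +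
    ENNReal.ofReal (1 / 2) • Measure.dirac 0

/-- This lets all `N` candidate environments be compared with one common base environment. -/
theorem lossLaw_zero (i j : Fin N) : lossLaw i 0 = lossLaw j 0 := by
  simp [lossLaw]

theorem isProbabilityMeasure_lossLaw (i : Fin N) {g : ℝ} (h0 : 0 ≤ g) (h1 : g ≤ 1 / 2) :
    IsProbabilityMeasure (lossLaw i g) := by
  refine ⟨?_⟩
  simp only [lossLaw, Measure.add_apply, Measure.smul_apply, measure_univ, smul_eq_mul, mul_one]
  rw [← ENNReal.ofReal_add (by linarith) h0, ← ENNReal.ofReal_add (by linarith) (by norm_num)]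
  norm_num

theorem integral_lossLaw (i : Fin N) {g : ℝ} (h0 : 0 ≤ g) (h1 : g ≤ 1 / 2) {f : Loss N → ℝ}
    (hf : Measurable f) :
    ∫ l, f l ∂lossLaw i g = (1 / 2 - g) * f 1 + g * f (spike i) + 1 / 2 * f 0 := by
  have hd : ∀ (a : ℝ) (l : Loss N), Integrable f (ENNReal.ofReal a • Measure.dirac l) :=
    fun a l => (integrable_dirac' hf.stronglyMeasurable (by simp)).smul_measure
      ENNReal.ofReal_ne_top
  rw [lossLaw, integral_add_measure ((hd _ _).add_measure (hd _ _)) (hd _ _),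
    integral_add_measure (hd _ _) (hd _ _)]
  simp only [integral_smul_measure, integral_dirac' _ _ hf.stronglyMeasurable, smul_eq_mul]
  rw [ENNReal.toReal_ofReal (by linarith), ENNReal.toReal_ofReal h0,
    ENNReal.toReal_ofReal (by norm_num)]

/-- The environment that draws independent losses, in which action `i` has the advantage `g n` in
round `n`. -/
def gapEnv (i : Fin N) (g : ℕ → Set.Icc (0 : ℝ) (1 / 2)) : Environment N where
  choose n := Kernel.const _ (lossLaw i (g n))
  markov n := by
    have := isProbabilityMeasure_lossLaw i (g n).2.1 (g n).2.2
    infer_instance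

/-- The expectation over loss and action of a function of one round, with the probability vector
`p` and the advantage `g` of action `i`. -/
def roundMean (i : Fin N) (g : ℝ) (p : Simplex N) (f : Round N → ℝ) : ℝ :=
  (1 / 2 - g) * ∑ j, p.1 j * f ((p, 1), j) + g * ∑ j, p.1 j * f ((p, spike i), j) +
    1 / 2 * ∑ j, p.1 j * f ((p, 0), j)

theorem integral_nextRound_gapEnv (alg : Algorithm N) (i : Fin N)
    (g : ℕ → Set.Icc (0 : ℝ) (1 / 2)) (n : ℕ) (h : Hist (Round N) n) {f : Round N → ℝ}
    (hf : BoundedMeasurable f) :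
    ∫ r, f r ∂nextRound alg (gapEnv i g) n h =
      ∫ p, roundMean i (g n) p f ∂alg.choose n (observe n h) := by
  unfold nextRound
  rw [ProbabilityTheory.integral_compProd (hf.integrable _)]
  simp only [Kernel.comap_apply, integral_draw]
  have hm : BoundedMeasurable
      (fun x : Simplex N × Loss N => ∑ j, x.1.1 j * f (x, j)) :=
    .sum _ fun j => ((boundedMeasurable_coord j).comp measurable_fst).mul
      (hf.comp (measurable_id.prodMk measurable_const))
  rw [ProbabilityTheory.integral_compProd (hm.integrable _)]
  refine integral_congr_ae (Filter.Eventually.of_forall fun p => ?_)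
  exact integral_lossLaw i (g n).2.1 (g n).2.2 (hm.1.comp (measurable_const.prodMk measurable_id))

theorem integral_law_gapEnv_succ (alg : Algorithm N) (i : Fin N)
    (g : ℕ → Set.Icc (0 : ℝ) (1 / 2)) (n : ℕ) {f : Hist (Round N) n × Round N → ℝ}
    (hf : BoundedMeasurable f) :
    ∫ x, f x ∂law alg (gapEnv i g) (n + 1) =
      ∫ h, ∫ p, roundMean i (g n) p (fun r => f (h, r)) ∂alg.choose n (observe n h)
        ∂law alg (gapEnv i g) n := by
  change ∫ x, f x ∂(law alg (gapEnv i g) n ⊗ₘ nextRound alg (gapEnv i g) n) = _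
  rw [Measure.integral_compProd (hf.integrable _)]
  refine integral_congr_ae (Filter.Eventually.of_forall fun h => ?_)
  exact integral_nextRound_gapEnv alg i g n h (hf.comp (measurable_const.prodMk measurable_id))

theorem BoundedMeasurable.total {X : Type} [MeasurableSpace X] {f : X → ℝ}
    (hf : BoundedMeasurable f) : (n : ℕ) → BoundedMeasurable (total f n)
  | 0 => BoundedMeasurable.const 0
  | n + 1 => ((BoundedMeasurable.total hf n).comp measurable_fst).add (hf.comp measurable_snd)

theorem total_observe (f : Feedback N → ℝ) :
    (n : ℕ) → (h : Hist (Round N) n) →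
      total f n (observe n h) = total (fun r => f (feedback r)) n h
  | 0, _ => rfl
  | n + 1, h => congrArg (· + f (feedback h.2)) (total_observe f n h.1)

/-- The expectation of a sum over rounds is the sum of the expected conditional means. -/
theorem integral_total_gapEnv (alg : Algorithm N) (i : Fin N)
    (g : ℕ → Set.Icc (0 : ℝ) (1 / 2)) {f : Round N → ℝ} (hf : BoundedMeasurable f) (n : ℕ) :
    ∫ h, total f n h ∂law alg (gapEnv i g) n =
      ∑ k ∈ Finset.range n, ∫ h, ∫ p, roundMean i (g k) p f ∂alg.choose k (observe k h)
        ∂law alg (gapEnv i g) k := by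
  induction n with
  | zero => simp [total]
  | succ n ih =>
    rw [Finset.sum_range_succ, ← ih]
    have hA := ((hf.total n).comp (measurable_fst (β := Round N)))
    have hB := hf.comp (measurable_snd (α := Hist (Round N) n))
    have h1 : ∫ h, total f (n + 1) h ∂law alg (gapEnv i g) (n + 1) =
        ∫ x, total f n x.1 + f x.2 ∂(law alg (gapEnv i g) n ⊗ₘ nextRound alg (gapEnv i g) n) := rfl
    rw [h1, integral_add (hA.integrable _) (hB.integrable _),
      Measure.integral_compProd (hA.integrable _), Measure.integral_compProd (hB.integrable _)]
    congr 1
    · simp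
    · refine integral_congr_ae (Filter.Eventually.of_forall fun h => ?_)
      exact integral_nextRound_gapEnv alg i g n h hf

/-! ### Means over a single round -/

theorem roundMean_eq_sum (i : Fin N) (g : ℝ) (p : Simplex N) (f : Round N → ℝ) :
    roundMean i g p f = ∑ j, p.1 j * ((1 / 2 - g) * f ((p, 1), j) + g * f ((p, spike i), j) +
      1 / 2 * f ((p, 0), j)) := by
  simp only [roundMean, Finset.mul_sum, ← Finset.sum_add_distrib]
  exact Finset.sum_congr rfl fun j _ => by ring

theorem roundMean_coord (i : Fin N) (g : ℝ) (p : Simplex N) (q : Simplex N → ℝ) :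
    roundMean i g p (fun r => q r.1.1) = q p := by
  rw [roundMean_eq_sum]
  dsimp only
  rw [← Finset.sum_mul, p.2.2]
  ring

/-- Constant loss vectors cause no regret, so only the spike, of weight `g`, contributes. -/
theorem roundMean_regret (i : Fin N) (g : ℝ) (p : Simplex N) :
    roundMean i g p (fun r => ∑ j, (r.1.2 j : ℝ) * r.1.1.1 j - (r.1.2 i : ℝ)) =
      g * (1 - p.1 i) := by
  have hs : ∑ j, ((spike i j : unitInterval) : ℝ) * p.1 j = 1 - p.1 i := by
    rw [← p.2.2, eq_sub_iff_add_eq, ← Finset.sum_erase_add _ _ (Finset.mem_univ i),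
      ← Finset.sum_erase_add _ p.1 (Finset.mem_univ i)]
    simp only [spike, if_true, Set.Icc.coe_zero, zero_mul, add_zero]
    congr 1
    refine Finset.sum_congr rfl fun j hj => ?_
    rw [if_neg (Finset.ne_of_mem_erase hj)]
    simp
  rw [roundMean_eq_sum]
  dsimp only
  rw [← Finset.sum_mul, p.2.2]
  have h1 : ∑ j, p.1 j = 1 := p.2.2
  simp only [hs]
  simp [h1, spike]

theorem roundMean_const_mul (i : Fin N) (g : ℝ) (p : Simplex N) (c : ℝ) (f : Round N → ℝ) :
    roundMean i g p (fun r => c * f r) = c * roundMean i g p f := by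
  rw [roundMean_eq_sum, roundMean_eq_sum, Finset.mul_sum]
  exact Finset.sum_congr rfl fun j _ => by ring

/-! ### Likelihood ratios and change of measure -/

/-- The logarithm of the likelihood ratio, for the feedback of one round, of the advantage `e` of
action `i` against no advantage. -/
def logRatio (i : Fin N) (e : ℝ) (x : Feedback N) : ℝ :=
  if x.2.1 = i then Real.log (1 + 2 * e * (1 - 2 * (x.2.2 : ℝ))) else 0

theorem boundedMeasurable_logRatio (i : Fin N) {e : ℝ} (h0 : 0 ≤ e) (h1 : e ≤ 1 / 4) :
    BoundedMeasurable (logRatio i e) := by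
  constructor
  · unfold logRatio
    refine Measurable.ite ?_ (by fun_prop) measurable_const
    exact (measurable_fst.comp measurable_snd) (measurableSet_singleton i)
  · refine ⟨1, fun x => ?_⟩
    unfold logRatio
    split_ifs
    · have hx0 := x.2.2.2.1
      have hx1 := x.2.2.2.2
      -- On `[1 / 2, 2]` the bounds `1 - 1 / y ≤ log y ≤ y - 1` give `|log y| ≤ 1`.
      have hl : 1 / 2 ≤ 1 + 2 * e * (1 - 2 * (x.2.2 : ℝ)) := by nlinarith
      have hu : 1 + 2 * e * (1 - 2 * (x.2.2 : ℝ)) ≤ 2 := by nlinarith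
      rw [abs_le]
      constructor
      · have := Real.one_sub_inv_le_log_of_pos (show 0 < 1 + 2 * e * (1 - 2 * (x.2.2 : ℝ)) by
          linarith)
        have h2 := inv_anti₀ (by norm_num) hl
        norm_num at h2
        linarith
      · have := Real.log_le_sub_one_of_pos (show 0 < 1 + 2 * e * (1 - 2 * (x.2.2 : ℝ)) by linarith)
        linarith
    · simp

theorem roundMean_logRatio (i : Fin N) (e : ℝ) (p : Simplex N) :
    roundMean i 0 p (fun r => logRatio i e (feedback r)) =
      (1 / 2 * (Real.log (1 - 2 * e) + Real.log (1 + 2 * e))) * p.1 i := by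
  rw [roundMean_eq_sum, Finset.sum_eq_single i]
  · simp only [logRatio, feedback, if_true, Pi.one_apply, Pi.zero_apply, Set.Icc.coe_one,
      Set.Icc.coe_zero]
    norm_num
    ring_nf
  · intro j _ hj
    simp [logRatio, feedback, hj]
  · simp

/-- Only one coordinate of the loss is seen, so only marginals matter: for `j ≠ i` both sides have a
fair coin, and for `i` the weights `1 ∓ 2 * e` turn the probabilities of losses `1` and `0` into `1
/ 2 ∓ e`. -/
theorem roundMean_change (i : Fin N) {e : ℝ} (h0 : 0 ≤ e) (h1 : e ≤ 1 / 4) (p : Simplex N)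
    (f : Feedback N → ℝ) :
    roundMean i e p (fun r => f (feedback r)) =
      roundMean i 0 p (fun r => Real.exp (logRatio i e (feedback r)) * f (feedback r)) := by
  rw [roundMean_eq_sum, roundMean_eq_sum]
  refine Finset.sum_congr rfl fun j _ => ?_
  by_cases hj : j = i
  · subst hj
    have e1 : Real.exp (logRatio j e (p, j, 1)) = 1 - 2 * e := by
      simp only [logRatio, if_true, Set.Icc.coe_one]
      rw [Real.exp_log (by linarith)]; ring
    have e0 : Real.exp (logRatio j e (p, j, 0)) = 1 + 2 * e := by
      simp only [logRatio, if_true, Set.Icc.coe_zero]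
      rw [Real.exp_log (by linarith)]; ring
    simp only [feedback, spike, if_true, Pi.one_apply, Pi.zero_apply, e1, e0]
    ring
  · have e1 : ∀ x, Real.exp (logRatio i e (p, j, x)) = 1 := fun x => by simp [logRatio, hj]
    simp only [feedback, spike, if_neg hj, Pi.one_apply, Pi.zero_apply, e1]
    ring

theorem boundedMeasurable_roundMean {α : Type*} [MeasurableSpace α] (i : Fin N) (g : ℝ)
    {f : α → Feedback N → ℝ} (hf : BoundedMeasurable (Function.uncurry f)) :
    BoundedMeasurable (fun x : α × Simplex N =>
      roundMean i g x.2 (fun r => f x.1 (feedback r))) := by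
  have h : ∀ (j : Fin N) (l : Loss N),
      BoundedMeasurable (fun x : α × Simplex N => f x.1 (feedback ((x.2, l), j))) := fun j l =>
    hf.comp (measurable_fst.prodMk (measurable_feedback.comp
      ((measurable_snd.prodMk measurable_const).prodMk measurable_const)))
  have hp := fun j : Fin N => (boundedMeasurable_coord j).comp (measurable_snd (α := α))
  have h' := fun l => BoundedMeasurable.sum Finset.univ fun j => (hp j).mul (h j l)
  exact (((BoundedMeasurable.const _).mul (h' _)).add ((BoundedMeasurable.const _).mul (h' _))).add
    ((BoundedMeasurable.const _).mul (h' _))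

/-- Change of measure: expectations of functions of the feedback under an environment in which `i`
has the advantage `e` are expectations under the environment without advantage, weighted by the
likelihood ratio. -/
theorem integral_observe_gapEnv (alg : Algorithm N) (i : Fin N) {e : ℝ} (h0 : 0 ≤ e)
    (h1 : e ≤ 1 / 4) (g z : ℕ → Set.Icc (0 : ℝ) (1 / 2)) (hz : ∀ k, (z k : ℝ) = 0) (n : ℕ)
    (hg : ∀ k < n, (g k : ℝ) = e) {f : Hist (Feedback N) n → ℝ} (hf : BoundedMeasurable f) :
    ∫ h, f (observe n h) ∂law alg (gapEnv i g) n =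
      ∫ h, Real.exp (total (logRatio i e) n (observe n h)) * f (observe n h)
        ∂law alg (gapEnv i z) n := by
  induction n with
  | zero =>
    change _ = ∫ h, Real.exp 0 * f (observe 0 h) ∂_
    simp only [Real.exp_zero, one_mul]
    rfl
  | succ n ih =>
    have hL := boundedMeasurable_logRatio i h0 h1
    have hF : BoundedMeasurable (Function.uncurry fun (o : Hist (Feedback N) n) x => f (o, x)) := hf
    have hobs := measurable_observe (N := N) (n + 1)
    have hW : BoundedMeasurable (fun x : Hist (Feedback N) (n + 1) =>
        Real.exp (total (logRatio i e) (n + 1) x) * f x) := (hL.total (n + 1)).exp.mul hf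
    -- The mean of `f` over the last round depends on the past only through the feedback, so the
    -- induction hypothesis applies to it.
    have hS := (boundedMeasurable_roundMean i e hF).integral_kernel
      (f := fun o p => roundMean i e p (fun r => f (o, feedback r))) (alg.choose n)
    have key1 := integral_law_gapEnv_succ alg i g n (hf.comp hobs)
    have key2 := integral_law_gapEnv_succ alg i z n (hW.comp hobs)
    have key3 := ih (fun k hk => hg k (hk.trans n.lt_succ_self)) hS
    refine key1.trans (Eq.trans ?_ (key3.trans (Eq.trans ?_ key2.symm)))
    · rw [hg n n.lt_succ_self]
      rfl
    · refine integral_congr_ae (Filter.Eventually.of_forall fun h => ?_)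
      dsimp only
      rw [← integral_const_mul]
      refine integral_congr_ae (Filter.Eventually.of_forall fun p => ?_)
      dsimp only
      rw [roundMean_change i h0 h1 p (fun x => f (observe n h, x)), ← roundMean_const_mul, hz n]
      refine congrArg (roundMean i 0 p) (funext fun r => ?_)
      change _ = Real.exp (total (logRatio i e) n (observe n h) + logRatio i e (feedback r)) *
        f (observe n h, feedback r)
      rw [Real.exp_add]
      ring

/-! ### Information bound on the number of plays -/

/-- A Pinsker-type inequality for a likelihood ratio `exp x`. -/
theorem abs_exp_sub_one_le (x : ℝ) :
    1 / 2 * |Real.exp x - 1| ≤ (Real.exp x - 1 - x) + (Real.exp x + 1) / 8 := by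
  -- Since `x ≤ 2 * (s - 1)`, the term `exp x - 1 - x` is at least `(s - 1) ^ 2`. The rest is AM-GM
  -- for `|s - 1| * (s + 1)` with `(s + 1) ^ 2 ≤ 2 * (s ^ 2 + 1)`.
  set s := Real.exp (x / 2) with hs
  have h1 : Real.exp x = s ^ 2 := by rw [hs, ← Real.exp_nat_mul]; congr 1; push_cast; ring
  have h2 : x / 2 + 1 ≤ s := Real.add_one_le_exp _
  rw [h1]
  have h3 : 1 / 2 * |s ^ 2 - 1| ≤ (s - 1) ^ 2 + (s ^ 2 + 1) / 8 := by
    cases abs_cases (s ^ 2 - 1) <;> nlinarith [sq_nonneg (4 * (s - 1) - (s + 1)),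
      sq_nonneg (4 * (s - 1) + (s + 1)), sq_nonneg (s - 1)]
  nlinarith

/-- The left side is the divergence, per play of `i`, of the base law from the law with advantage
`e`. It is at most `(1 / (1 - 4 * e ^ 2) - 1) / 2`, where `4 * e ^ 2 ≤ 1 / 4`. -/
theorem neg_log_ratio_le {e : ℝ} (h0 : 0 ≤ e) (h1 : e ≤ 1 / 4) :
    -(1 / 2 * (Real.log (1 - 2 * e) + Real.log (1 + 2 * e))) ≤ 8 / 3 * e ^ 2 := by
  rw [← Real.log_mul (by linarith) (by linarith)]
  have hpos : 0 < (1 - 2 * e) * (1 + 2 * e) := by nlinarith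
  have h := Real.one_sub_inv_le_log_of_pos hpos
  have h2 : ((1 - 2 * e) * (1 + 2 * e))⁻¹ ≤ 1 + 16 / 3 * e ^ 2 := by
    rw [inv_le_iff_one_le_mul₀ hpos]
    nlinarith [mul_nonneg (sq_nonneg e) (show 0 ≤ 1 / 16 - e ^ 2 by nlinarith)]
  linarith

theorem total_nonneg {X : Type} {f : X → ℝ} (hf : ∀ x, 0 ≤ f x) :
    (n : ℕ) → (h : Hist X n) → 0 ≤ total f n h
  | 0, _ => le_rfl
  | n + 1, h => add_nonneg (total_nonneg hf n h.1) (hf h.2)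

theorem total_le {X : Type} {f : X → ℝ} (hf : ∀ x, f x ≤ 1) :
    (n : ℕ) → (h : Hist X n) → total f n h ≤ n
  | 0, _ => by simp [total]
  | n + 1, h => by
    push_cast
    exact add_le_add (total_le hf n h.1) (hf h.2)

theorem sum_total {X ι : Type} (s : Finset ι) (f : ι → X → ℝ) :
    (n : ℕ) → (h : Hist X n) → ∑ i ∈ s, total (f i) n h = total (fun x => ∑ i ∈ s, f i x) n h
  | 0, _ => by simp [total]
  | n + 1, h => by
    simp only [total, Finset.sum_add_distrib, sum_total s f n h.1]

theorem total_one {X : Type} : (n : ℕ) → (h : Hist X n) → total (fun _ => 1) n h = n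
  | 0, _ => by simp [total]
  | n + 1, h => by simp only [total, total_one n h.1]; push_cast; rfl

/-- The number of times that action `i` is played, conditionally on the probability vectors. -/
def plays (i : Fin N) (n : ℕ) (h : Hist (Round N) n) : ℝ := total (fun r => r.1.1.1 i) n h

theorem boundedMeasurable_plays (i : Fin N) (n : ℕ) : BoundedMeasurable (plays i n) :=
  BoundedMeasurable.total
    ((boundedMeasurable_coord i).comp (measurable_fst.comp measurable_fst)) n

theorem sum_plays (n : ℕ) (h : Hist (Round N) n) : ∑ i, plays i n h = n := by
  have h1 : ∀ r : Round N, ∑ i, r.1.1.1 i = 1 := fun r => r.1.1.2.2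
  simp only [plays, sum_total, h1, total_one]

/-- The expected log-likelihood ratio under the environment without advantage. -/
theorem integral_logRatio (alg : Algorithm N) (i : Fin N) {e : ℝ} (h0 : 0 ≤ e)
    (h1 : e ≤ 1 / 4) (z : ℕ → Set.Icc (0 : ℝ) (1 / 2)) (hz : ∀ k, (z k : ℝ) = 0) (n : ℕ) :
    ∫ h, total (logRatio i e) n (observe n h) ∂law alg (gapEnv i z) n =
      (1 / 2 * (Real.log (1 - 2 * e) + Real.log (1 + 2 * e))) *
        ∫ h, plays i n h ∂law alg (gapEnv i z) n := by
  have hL := (boundedMeasurable_logRatio i h0 h1).comp (measurable_feedback (N := N))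
  have hp : BoundedMeasurable (fun r : Round N => r.1.1.1 i) :=
    (boundedMeasurable_coord i).comp (measurable_fst.comp measurable_fst)
  simp only [total_observe, plays]
  rw [integral_total_gapEnv alg i z hL, integral_total_gapEnv alg i z hp, Finset.mul_sum]
  refine Finset.sum_congr rfl fun k _ => ?_
  simp only [hz, roundMean_logRatio, roundMean_coord i 0 _ (fun p => p.1 i), integral_const_mul]

/-- A small advantage of an action changes the expected number of its plays only little. -/
theorem integral_plays_le (alg : Algorithm N) (i : Fin N) {e : ℝ} (h0 : 0 ≤ e)
    (h1 : e ≤ 1 / 4) (g z : ℕ → Set.Icc (0 : ℝ) (1 / 2)) (hz : ∀ k, (z k : ℝ) = 0) (n : ℕ)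
    (hg : ∀ k < n, (g k : ℝ) = e) :
    ∫ h, plays i n h ∂law alg (gapEnv i g) n ≤
      (∫ h, plays i n h ∂law alg (gapEnv i z) n) +
        n * (1 / 4 + 8 / 3 * e ^ 2 * ∫ h, plays i n h ∂law alg (gapEnv i z) n) := by
  have hp : BoundedMeasurable (fun x : Feedback N => x.1.1 i) :=
    (boundedMeasurable_coord i).comp measurable_fst
  have hobs : ∀ h : Hist (Round N) n,
      plays i n h = total (fun x : Feedback N => x.1.1 i) n (observe n h) := fun h =>
    (total_observe (fun x : Feedback N => x.1.1 i) n h).symm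
  have hL := ((boundedMeasurable_logRatio i h0 h1).total n).comp (measurable_observe (N := N) n)
  have hP := boundedMeasurable_plays i n
  set μ := law alg (gapEnv i z) n
  have hchange := integral_observe_gapEnv alg i h0 h1 g z hz n hg (hp.total n)
  have hone := integral_observe_gapEnv alg i h0 h1 g z hz n hg (BoundedMeasurable.const 1)
  simp only [mul_one, integral_const, probReal_univ, smul_eq_mul, ← hobs] at hchange hone
  rw [hchange]
  -- As `0 ≤ plays ≤ n`, only the positive part of `exp x - 1` matters. It is half the absolute
  -- value, bounded by `abs_exp_sub_one_le`, plus `(exp x - 1) / 2`. Since `exp x` has mean `1`, the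
  -- bracket has mean `1 / 4` plus the divergence. This bound, unlike Pinsker's with its square
  -- root, is linear in the divergence and can be summed over `i`.
  have hpt : ∀ h : Hist (Round N) n,
      Real.exp (total (logRatio i e) n (observe n h)) * plays i n h ≤
        plays i n h + n * ((13 / 8 * Real.exp (total (logRatio i e) n (observe n h)) - 11 / 8) -
          total (logRatio i e) n (observe n h)) := by
    intro h
    have hP0 : 0 ≤ plays i n h := total_nonneg (fun r => r.1.1.2.1 i) n h
    have hPn : plays i n h ≤ n :=
      total_le (f := fun r : Round N => r.1.1.1 i) (fun r => coord_le_one r.1.1 i) n h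
    set x := total (logRatio i e) n (observe n h)
    have hx := abs_exp_sub_one_le x
    have h2 : (Real.exp x - 1) * plays i n h ≤
        (1 / 2 * |Real.exp x - 1| + 1 / 2 * (Real.exp x - 1)) * n := by
      cases abs_cases (Real.exp x - 1) <;> nlinarith
    have h3 := mul_le_mul_of_nonneg_left hx (hP0.trans hPn)
    linarith
  refine (integral_mono ((hL.exp.mul hP).integrable μ) ((hP.add ((BoundedMeasurable.const _).mul
    ((((BoundedMeasurable.const _).mul hL.exp).sub (.const _)).sub hL))).integrable μ) hpt).trans ?_
  have e13 := (BoundedMeasurable.const (α := Hist (Round N) n) (13 / 8)).mul hL.exp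
  have e11 := BoundedMeasurable.const (α := Hist (Round N) n) (11 / 8)
  rw [integral_add (hP.integrable μ)
      (((BoundedMeasurable.const _).mul ((e13.sub e11).sub hL)).integrable μ),
    integral_const_mul, integral_sub ((e13.sub e11).integrable μ) (hL.integrable μ),
    integral_sub (e13.integrable μ) (e11.integrable μ), integral_const_mul, ← hone,
    integral_logRatio alg i h0 h1 z hz n]
  simp only [integral_const, probReal_univ, smul_eq_mul]
  have hpos : 0 ≤ ∫ h, plays i n h ∂μ :=
    integral_nonneg fun h => total_nonneg (fun r => r.1.1.2.1 i) n h
  have hk := mul_le_mul_of_nonneg_right (neg_log_ratio_le h0 h1) hpos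
  gcongr
  linarith

/-- Some action with a small advantage is played in at most two thirds of the rounds. -/
theorem exists_integral_plays_le (hN : 4 ≤ N) (alg : Algorithm N) {e : ℝ} (h0 : 0 ≤ e)
    (h1 : e ≤ 1 / 4) (g : ℕ → Set.Icc (0 : ℝ) (1 / 2)) (n : ℕ) (hn : n * e ^ 2 ≤ N / 16)
    (hg : ∀ k < n, (g k : ℝ) = e) :
    ∃ i : Fin N, ∫ h, plays i n h ∂law alg (gapEnv i g) n ≤ 2 / 3 * n := by
  by_contra! hcon
  let z : ℕ → Set.Icc (0 : ℝ) (1 / 2) := fun _ => ⟨0, by norm_num, by norm_num⟩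
  have hz : ∀ k, (z k : ℝ) = 0 := fun _ => rfl
  let i₀ : Fin N := ⟨0, by omega⟩
  have hbase : ∀ i : Fin N, gapEnv i z = gapEnv i₀ z := by
    intro i
    simp only [gapEnv, hz, lossLaw_zero i i₀]
  set D : Fin N → ℝ := fun i => ∫ h, plays i n h ∂law alg (gapEnv i₀ z) n with hD
  have hsum : ∑ i, D i = n := by
    rw [hD, ← integral_finsetSum _ fun i _ => (boundedMeasurable_plays i n).integrable _]
    simp only [sum_plays, integral_const, probReal_univ, smul_eq_mul, one_mul]
  have hle : ∀ i, 2 / 3 * (n : ℝ) < D i + n * (1 / 4 + 8 / 3 * e ^ 2 * D i) := fun i => by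
    have := integral_plays_le alg i h0 h1 g z hz n hg
    rw [hbase i] at this
    exact (hcon i).trans_le this
  -- The sum gives `2 / 3 * n * N < n + n * N / 4 + 8 / 3 * e ^ 2 * n ^ 2`, whose last term is at
  -- most `n * N / 6`. So `n * N / 4 < n`, against `4 ≤ N`.
  have htot := Finset.sum_lt_sum_of_nonempty (s := Finset.univ) ⟨i₀, Finset.mem_univ _⟩
    fun i _ => hle i
  simp only [Finset.sum_add_distrib, ← Finset.mul_sum, hsum, Finset.sum_const, Finset.card_univ,
    Fintype.card_fin, nsmul_eq_mul] at htot
  have hN' : (4 : ℝ) ≤ N := by exact_mod_cast hN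
  have hn0 : (0 : ℝ) ≤ n := n.cast_nonneg
  have a1 := mul_le_mul_of_nonneg_left hn hn0
  have a2 := mul_le_mul_of_nonneg_left hN' hn0
  nlinarith

/-! ### Regret and the self-bounding constraint -/

/-- The expected probability of playing another action than `i` in round `k`. -/
def missProb (alg : Algorithm N) (env : Environment N) (i : Fin N) (k : ℕ) : ℝ :=
  ∫ h, ∫ p, (1 - p.1 i) ∂alg.choose k (observe k h) ∂law alg env k

theorem missProb_nonneg (alg : Algorithm N) (env : Environment N) (i : Fin N) (k : ℕ) :
    0 ≤ missProb alg env i k :=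
  integral_nonneg fun _ => integral_nonneg fun p => sub_nonneg.2 (coord_le_one p i)

theorem missProb_le_one (alg : Algorithm N) (env : Environment N) (i : Fin N) (k : ℕ) :
    missProb alg env i k ≤ 1 := by
  have hb : BoundedMeasurable (fun p : Simplex N => 1 - p.1 i) :=
    (BoundedMeasurable.const 1).sub (boundedMeasurable_coord i)
  have hk := ((hb.comp (measurable_snd (α := Hist (Feedback N) k))).integral_kernel
    (f := fun _ p => 1 - p.1 i) (alg.choose k)).comp (measurable_observe k)
  have h1 : ∀ h, ∫ p, (1 - p.1 i) ∂alg.choose k (observe k h) ≤ 1 := fun h => by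
    refine (integral_mono (hb.integrable _) ((BoundedMeasurable.const 1).integrable _)
      fun p => sub_le_self _ (p.2.1 i)).trans ?_
    simp
  refine (integral_mono (hk.integrable _) ((BoundedMeasurable.const 1).integrable _) h1).trans ?_
  simp

theorem integral_total_miss (alg : Algorithm N) (i : Fin N)
    (g : ℕ → Set.Icc (0 : ℝ) (1 / 2)) (n : ℕ) :
    ∫ h, total (fun r : Round N => 1 - r.1.1.1 i) n h ∂law alg (gapEnv i g) n =
      ∑ k ∈ Finset.range n, missProb alg (gapEnv i g) i k := by
  have hb : BoundedMeasurable (fun r : Round N => 1 - r.1.1.1 i) := (BoundedMeasurable.const 1).sub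
    ((boundedMeasurable_coord i).comp (measurable_fst.comp measurable_fst))
  rw [integral_total_gapEnv alg i g hb]
  refine Finset.sum_congr rfl fun k _ => ?_
  simp only [roundMean_coord i _ _ (fun p => 1 - p.1 i), missProb]

theorem pseudoRegret_gapEnv (alg : Algorithm N) (i : Fin N)
    (g : ℕ → Set.Icc (0 : ℝ) (1 / 2)) (n : ℕ) :
    pseudoRegret alg (gapEnv i g) n i =
      ∑ k ∈ Finset.range n, (g k : ℝ) * missProb alg (gapEnv i g) i k := by
  have hl : ∀ j : Fin N, BoundedMeasurable (fun r : Round N => (r.1.2 j : ℝ)) := fun j =>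
    ⟨by fun_prop, 1, fun r => by
      rw [abs_of_nonneg (r.1.2 j).2.1]; exact (r.1.2 j).2.2⟩
  have hb : BoundedMeasurable
      (fun r : Round N => ∑ j, (r.1.2 j : ℝ) * r.1.1.1 j - (r.1.2 i : ℝ)) :=
    (BoundedMeasurable.sum _ fun j => (hl j).mul
      ((boundedMeasurable_coord j).comp (measurable_fst.comp measurable_fst))).sub (hl i)
  rw [pseudoRegret, integral_total_gapEnv alg i g hb]
  refine Finset.sum_congr rfl fun k _ => ?_
  simp only [roundMean_regret, integral_const_mul, missProb]

/-- The advantages of size `e` in the first `m` rounds and of size `1 / 2` afterwards. -/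
def gaps (e : ℝ) (he : e ∈ Set.Icc (0 : ℝ) (1 / 2)) (m k : ℕ) : Set.Icc (0 : ℝ) (1 / 2) :=
  if k < m then ⟨e, he⟩ else ⟨1 / 2, by norm_num, le_rfl⟩

/-- After round `m` the advantage `1 / 2` dominates `Δ` termwise. Before it, either `e` does, or the
whole right-hand contribution is at most `m * Δ ≤ C`. -/
theorem selfBounding_gaps (i : Fin N) {e Δ C : ℝ} (he : e ∈ Set.Icc (0 : ℝ) (1 / 2))
    (hΔ0 : 0 ≤ Δ) (hΔ : Δ ≤ 1 / 2) (hC : 0 ≤ C) (m n : ℕ) (hmn : m ≤ n)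
    (h : Δ ≤ e ∨ m * Δ ≤ C) : SelfBounding (gapEnv i (gaps e he m)) i Δ C n := by
  intro alg
  rw [integral_total_miss, pseudoRegret_gapEnv, Finset.mul_sum, sub_le_iff_le_add,
    ← Finset.sum_range_add_sum_Ico _ hmn, ← Finset.sum_range_add_sum_Ico _ hmn]
  set d := missProb alg (gapEnv i (gaps e he m)) i
  have hd0 : ∀ k, 0 ≤ d k := missProb_nonneg alg _ i
  have hd1 : ∀ k, d k ≤ 1 := missProb_le_one alg _ i
  have htail : ∑ k ∈ Finset.Ico m n, Δ * d k ≤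
      ∑ k ∈ Finset.Ico m n, (gaps e he m k : ℝ) * d k := by
    refine Finset.sum_le_sum fun k hk => mul_le_mul_of_nonneg_right ?_ (hd0 k)
    rw [gaps, if_neg (not_lt.2 (Finset.mem_Ico.1 hk).1)]
    exact hΔ
  have hhead : ∑ k ∈ Finset.range m, Δ * d k ≤
      ∑ k ∈ Finset.range m, (gaps e he m k : ℝ) * d k + C := by
    rcases h with h | h
    · refine (Finset.sum_le_sum fun k hk => mul_le_mul_of_nonneg_right ?_ (hd0 k)).trans
        (le_add_of_nonneg_right hC)
      rw [gaps, if_pos (Finset.mem_range.1 hk)]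
      exact h
    · have h1 : ∑ k ∈ Finset.range m, Δ * d k ≤ m * Δ := by
        refine (Finset.sum_le_card_nsmul _ _ Δ fun k _ =>
          mul_le_of_le_one_right hΔ0 (hd1 k)).trans_eq ?_
        simp
      have h2 : 0 ≤ ∑ k ∈ Finset.range m, (gaps e he m k : ℝ) * d k :=
        Finset.sum_nonneg fun k _ => mul_nonneg (gaps e he m k).2.1 (hd0 k)
      linarith
  linarith

/-- At least `m / 3` expected misses in the first phase cost `e` each, and later rounds only add
nonnegative regret. -/
theorem exists_le_pseudoRegret (hN : 4 ≤ N) (alg : Algorithm N) {e Δ C : ℝ} (h0 : 0 ≤ e)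
    (h1 : e ≤ 1 / 4) (hΔ0 : 0 ≤ Δ) (hΔ : Δ ≤ 1 / 2) (hC : 0 ≤ C) {m n : ℕ} (hmn : m ≤ n)
    (hm : m * e ^ 2 ≤ N / 16) (h : Δ ≤ e ∨ m * Δ ≤ C) :
    ∃ (i : Fin N) (env : Environment N), SelfBounding env i Δ C n ∧
      e * m / 3 ≤ pseudoRegret alg env n i := by
  have he : e ∈ Set.Icc (0 : ℝ) (1 / 2) := ⟨h0, by linarith⟩
  have hg : ∀ k < m, (gaps e he m k : ℝ) = e := fun k hk => by rw [gaps, if_pos hk]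
  obtain ⟨i, hi⟩ := exists_integral_plays_le hN alg h0 h1 (gaps e he m) m hm hg
  refine ⟨i, gapEnv i (gaps e he m), selfBounding_gaps i he hΔ0 hΔ hC m n hmn h, ?_⟩
  have hmiss := integral_total_miss alg i (gaps e he m) m
  have hplays : ∀ x : Hist (Round N) m,
      total (fun r : Round N => 1 - r.1.1.1 i) m x = m - plays i m x := by
    clear hm hg hi hmiss hmn h
    intro x
    induction m with
    | zero => simp [total, plays]
    | succ m ih =>
      have := ih x.1
      simp only [plays, total] at this ⊢
      rw [this]
      push_cast
      ring
  simp only [hplays] at hmiss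
  rw [integral_sub ((BoundedMeasurable.const _).integrable _)
    ((boundedMeasurable_plays i m).integrable _)] at hmiss
  simp only [integral_const, probReal_univ, smul_eq_mul, one_mul] at hmiss
  rw [pseudoRegret_gapEnv, ← Finset.sum_range_add_sum_Ico _ hmn]
  have htail : 0 ≤ ∑ k ∈ Finset.Ico m n,
      (gaps e he m k : ℝ) * missProb alg (gapEnv i (gaps e he m)) i k :=
    Finset.sum_nonneg fun k _ => mul_nonneg (gaps e he m k).2.1 (missProb_nonneg alg _ i k)
  have hhead : ∑ k ∈ Finset.range m,
      (gaps e he m k : ℝ) * missProb alg (gapEnv i (gaps e he m)) i k =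
      e * ∑ k ∈ Finset.range m, missProb alg (gapEnv i (gaps e he m)) i k := by
    rw [Finset.mul_sum]
    exact Finset.sum_congr rfl fun k hk => by rw [hg k (Finset.mem_range.1 hk)]
  rw [hhead, ← hmiss]
  have := mul_le_mul_of_nonneg_left hi h0
  linarith

end Bandit

end

/-! ### Choice of parameters and conclusion -/

namespace Bandit

/-- The choice of the size `e` and the duration `m` of the advantage. -/
theorem exists_gap_and_duration {Δ C : ℝ} {N T : ℕ} (hΔ0 : 0 < Δ) (hΔ : Δ < 1 / 4) (hN : 4 ≤ N)
    (hC : 0 ≤ C) :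
    ∃ (e : ℝ) (m : ℕ), 0 ≤ e ∧ e ≤ 1 / 4 ∧ m ≤ T ∧ m * e ^ 2 ≤ N / 16 ∧
      (Δ ≤ e ∨ m * Δ ≤ C) ∧
      1 / 200 * min (min (N / Δ + √(C * N / Δ)) √(N * T)) T ≤ e * m / 3 := by
  have hN' : (4 : ℝ) ≤ N := by exact_mod_cast hN
  have hfloor : ∀ x : ℝ, 2 ≤ x → x / 2 ≤ ⌊x⌋₊ := fun x hx => by
    have := Nat.lt_floor_add_one x
    linarith
  have hT0 : (0 : ℝ) ≤ T := T.cast_nonneg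
  set M := min (min (N / Δ + √(C * N / Δ)) √(N * T)) (T : ℝ)
  have hMT : M ≤ T := min_le_right _ _
  have hMS : M ≤ √(N * T) := (min_le_left _ _).trans (min_le_right _ _)
  have hMC : M ≤ N / Δ + √(C * N / Δ) := (min_le_left _ _).trans (min_le_left _ _)
  rcases le_or_gt T N with hTN | hTN
  · have hTN' : (T : ℝ) ≤ N := by exact_mod_cast hTN
    exact ⟨1 / 4, T, by norm_num, le_rfl, le_rfl, by linarith, Or.inl hΔ.le, by linarith⟩
  -- This is `e = √(N / m) / 4`, the largest value with `m * e ^ 2 ≤ N / 16`; `N ≤ m` keeps it below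
  -- `1 / 4`.
  have hsq : ∀ m : ℕ, N ≤ m → 0 ≤ √(N * m) / (4 * m) ∧ √(N * m) / (4 * m) ≤ 1 / 4 ∧
      m * (√(N * m) / (4 * m)) ^ 2 ≤ N / 16 ∧ √(N * m) / (4 * m) * m / 3 = √(N * m) / 12 := by
    intro m hm
    have hm' : (N : ℝ) ≤ m := by exact_mod_cast hm
    have hm0 : (0 : ℝ) < m := by linarith
    refine ⟨by positivity, ?_, ?_, by field_simp; norm_num⟩
    · rw [div_le_iff₀ (by positivity)]
      refine (Real.sqrt_le_left (by linarith)).2 ?_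
      nlinarith
    · rw [div_pow, Real.sq_sqrt (by positivity)]
      apply le_of_eq
      field_simp
      norm_num
  have hTN' : (N : ℝ) ≤ T := by exact_mod_cast hTN.le
  -- At `C = N / Δ` the terms `N / Δ` and `√(C * N / Δ)` are equal. Below it `C` is not used and `Δ
  -- ≤ e` is kept.
  rcases le_or_gt C (N / Δ) with hCN | hCN
  · have hM2 : M ≤ 2 * (N / Δ) := by
      have : √(C * N / Δ) ≤ N / Δ := by
        refine (Real.sqrt_le_left (by positivity)).2 ?_
        rw [mul_div_assoc, sq]
        exact mul_le_mul_of_nonneg_right hCN (by positivity)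
      linarith
    rcases le_or_gt (N / (16 * Δ ^ 2)) (T : ℝ) with hT | hT
    · have hx : 2 ≤ (N : ℝ) / (16 * Δ ^ 2) := by
        rw [le_div_iff₀ (by positivity)]
        nlinarith
      have hfl := Nat.floor_le (show 0 ≤ (N : ℝ) / (16 * Δ ^ 2) by positivity)
      refine ⟨Δ, ⌊(N : ℝ) / (16 * Δ ^ 2)⌋₊, hΔ0.le, hΔ.le, ?_, ?_, Or.inl le_rfl, ?_⟩
      · exact_mod_cast hfl.trans hT
      · refine (mul_le_mul_of_nonneg_right hfl (sq_nonneg Δ)).trans_eq ?_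
        field_simp
      -- The worst case for the constant: `M ≤ 2 * (N / Δ)`, while `e * m / 3` is at least `N / Δ /
      -- 96`, half being lost to rounding. This would allow `1 / 192`.
      · have h1 := mul_le_mul_of_nonneg_left (hfloor _ hx) hΔ0.le
        have h2 : Δ * ((N : ℝ) / (16 * Δ ^ 2) / 2) = N / Δ / 32 := by
          field_simp
          norm_num
        have h3 : 0 ≤ (N : ℝ) / Δ := by positivity
        linarith
    · obtain ⟨h1, h2, h3, h4⟩ := hsq T hTN.le
      refine ⟨_, T, h1, h2, le_rfl, h3, Or.inl ?_, ?_⟩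
      · rw [le_div_iff₀ (by linarith)]
        refine Real.le_sqrt_of_sq_le ?_
        rw [lt_div_iff₀ (by positivity)] at hT
        nlinarith
      · rw [h4]
        have := Real.sqrt_nonneg ((N : ℝ) * T)
        linarith
  -- Here `C` pays for up to `C / Δ` rounds, so `e` may drop below `Δ`; the duration is the longest
  -- allowed by `C` and `T`.
  · have hx : (N : ℝ) + 2 ≤ C / Δ := by
      have h1 : (N : ℝ) / Δ / Δ ≤ C / Δ := by gcongr
      refine le_trans ?_ h1
      rw [div_div, le_div_iff₀ (by positivity)]
      have h2 : Δ * Δ ≤ 1 / 16 := by nlinarith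
      have h3 := mul_le_mul_of_nonneg_left h2 (show (0 : ℝ) ≤ N + 2 by linarith)
      linarith
    have hfl := Nat.floor_le (show 0 ≤ C / Δ by positivity)
    have hNm : N ≤ min T ⌊C / Δ⌋₊ := le_min hTN.le (Nat.le_floor (by linarith))
    obtain ⟨h1, h2, h3, h4⟩ := hsq _ hNm
    refine ⟨_, min T ⌊C / Δ⌋₊, h1, h2, min_le_left _ _, h3, Or.inr ?_, ?_⟩
    · rw [← le_div_iff₀ hΔ0]
      exact le_trans (by exact_mod_cast min_le_right _ _) hfl
    · rw [h4]
      rcases min_choice T ⌊C / Δ⌋₊ with hmin | hmin <;> rw [hmin]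
      · have := Real.sqrt_nonneg ((N : ℝ) * T)
        linarith
      · have hbig : N / Δ ≤ √(C * N / Δ) := by
          refine Real.le_sqrt_of_sq_le ?_
          rw [mul_div_assoc, sq]
          exact mul_le_mul_of_nonneg_right hCN.le (by positivity)
        have hroot : √(C * N / Δ) / 2 ≤ √(N * ⌊C / Δ⌋₊) := by
          refine Real.le_sqrt_of_sq_le ?_
          rw [div_pow, Real.sq_sqrt (by positivity)]
          have h5 := mul_le_mul_of_nonneg_left (hfloor (C / Δ) (by linarith))
            (show (0 : ℝ) ≤ N by positivity)
          have h6 : C * N / Δ = N * (C / Δ) := by ring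
          have h7 : 0 ≤ N * (C / Δ) := by positivity
          rw [h6]
          linarith
        have := Real.sqrt_nonneg (C * N / Δ)
        linarith

end Bandit

theorem theorem6 :
    ∃ c : ℝ, 0 < c ∧
      ∀ (Δ : ℝ) (N T : ℕ) (C : ℝ),
        0 < Δ → Δ < 1 / 4 → 4 ≤ N → 4 * Real.log N ≤ T → 0 ≤ C →
        ∀ alg : Bandit.Algorithm N,
          ∃ (i : Fin N) (env : Bandit.Environment N),
            Bandit.SelfBounding env i Δ C T ∧
            c * min (min (N / Δ + √(C * N / Δ)) √(N * T)) T ≤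
              Bandit.pseudoRegret alg env T i := by
  refine ⟨1 / 200, by norm_num, fun Δ N T C hΔ0 hΔ hN _ hC alg => ?_⟩
  obtain ⟨e, m, h0, h1, hmT, hm, hor, hle⟩ :=
    Bandit.exists_gap_and_duration (T := T) hΔ0 hΔ hN hC
  obtain ⟨i, env, hself, hreg⟩ := Bandit.exists_le_pseudoRegret hN alg h0 h1 hΔ0.le
    (hΔ.le.trans (by norm_num)) hC hmT hm hor
  exact ⟨i, env, hself, hle.trans hreg⟩
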